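/- Let $\Delta=\{z\in\mathbb C:|z|<1\}$. Let $\varphi\in(-\pi/2,\pi/2)$, $\alpha<\cos\varphi$, $\beta\in\left(0,\frac{\alpha}{\cos\varphi}\right]$, and put $\mu=e^{i\varphi}\,\frac{2(\cos\varphi-\alpha)}{1-\beta}$. Let $s:\Delta\to\mathbb C$ be a univalent (holomorphic and injective) function with $s(0)=0$, $s'(0)=1$ and $$\operatorname{Re}\left(e^{-i\varphi}\,\frac{z s'(z)}{s(z)}\right)>\alpha\qquad(z\in\Delta\setminus\{0\}).$$ Let $(1-z)^{1/\beta}$ be the principal branch, and let $\left(\frac{s(z)}{z}\right)^{1/(\mu\beta)}$ be the holomorphic branch on $\Delta$ with value $1$ at $z=0$, that is, $\exp\left(\frac{1}{\mu\beta}L(z)\right)$, where $L$ is the holomorphic function on $\Delta$ with $L(0)=0$ and $e^{L(z)}=s(z)/z$ for $z\neq0$ (this branch exists). Write $$Q(z)=(1-z)^{1/\beta}\left(\frac{s(z)}{z}\right)^{1/(\mu\beta)}\qquad(z\in\Delta).$$ Then the image of $\Delta$ under $1-Q$ contains the open unit disk $\Delta$, and the image of $\{z\in\Delta: Q(z)\ne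 2\}$ under the function $$\frac{Q(z)}{2-Q(z)}=\frac{(1-z)^{1/\beta}\left(\frac{s(z)}{z}\right)^{1/(\mu\beta)}}{2-(1-z)^{1/\beta}\left(\frac{s(z)}{z}\right)^{1/(\mu\beta)}}$$ contains the right half-plane $\{w\in\mathbb C:\operatorname{Re}w>0\}$. -/

import Mathlib

/-- `p` is the holomorphic branch on the open unit disk of the power `(s(z)/z) ^ c` that takes the
value `1` at `z = 0`. That is, `p = exp (c * L)`, where `L` is the holomorphic logarithm of `s(z)/z`
on the disk with `L 0 = 0`. (For holomorphic `s` with `s 0 = 0` and `s' 0 = 1` the quotient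
`s(z)/z` has a removable singularity with value `1` at `z = 0`. The principal power cannot be used
here, since `s(z)/z` may cross the negative real axis.) -/
def IsQuotientPowerBranch (s : ℂ → ℂ) (c : ℂ) (p : ℂ → ℂ) : Prop :=
  ∃ L : ℂ → ℂ, DifferentiableOn ℂ L (Metric.ball 0 1) ∧ L 0 = 0 ∧
    (∀ z ∈ Metric.ball (0 : ℂ) 1, z ≠ 0 → Complex.exp (L z) = s z / z) ∧
    ∀ z ∈ Metric.ball (0 : ℂ) 1, p z = Complex.exp (c * L z)

section

open Complex Metric Set Filter Topology

/-! Put `d = 2 * (cos φ - α)` and `M = (e^{-iφ} / d) * L`. The spiral condition becomes `Re (z M') >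
-1/2`, and `Q = exp W` where `log (1 - z) = β W + (1 - β) (-M)`, a convex combination because `0 < β
< 1`. Marx–Strohhäcker with Schwarz's lemma gives `|1 - exp (-M z)| ≤ |z|`. If also `|1 - exp (W z)|
< |z|` on the strip `|Im| < π/2`, convexity of the logarithm of the disk of radius `|z|` about `1`
would give `|1 - (1 - z)| < |z|`, which is absurd. Hence `|z| ≤ |1 - Q z|` whenever `W z` lies in
the strip. This properness, the open mapping theorem and connectedness make `W` cover the logarithm
of the unit disk about `1` (`log_ball_subset_image`). The half-plane statement follows by a Möbius
map. -/

/-! ### Logarithms of disks about 1 -/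

theorem normSq_one_sub_exp (w : ℂ) :
    ‖1 - exp w‖ ^ 2 = Real.exp w.re * (Real.exp w.re - 2 * Real.cos w.im) + 1 := by
  rw [← Complex.normSq_eq_norm_sq, Complex.normSq_apply]
  simp only [sub_re, one_re, sub_im, one_im, exp_re, exp_im]
  linear_combination (Real.exp w.re) ^ 2 * Real.sin_sq_add_cos_sq w.im

/-- Dividing by `exp w.re` separates the variables: for `r ≤ 1` the second factor is convex in
`w.re`, and it is convex in `w.im` on `|w.im| ≤ π/2`. -/
theorem exp_mul_eq_normSq_one_sub_exp_sub (w : ℂ) (r : ℝ) :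
    Real.exp w.re * (Real.exp w.re + (1 - r ^ 2) * Real.exp (-w.re) - 2 * Real.cos w.im) =
      ‖1 - exp w‖ ^ 2 - r ^ 2 := by
  have h : Real.exp w.re * Real.exp (-w.re) = 1 := by rw [← Real.exp_add]; simp
  rw [normSq_one_sub_exp]
  linear_combination (1 - r ^ 2) * h

theorem norm_one_sub_exp_lt_iff {w : ℂ} {r : ℝ} (hr : 0 ≤ r) :
    ‖1 - exp w‖ < r ↔
      Real.exp w.re + (1 - r ^ 2) * Real.exp (-w.re) - 2 * Real.cos w.im < 0 := by
  rw [← sq_lt_sq₀ (norm_nonneg _) hr, ← sub_neg, ← exp_mul_eq_normSq_one_sub_exp_sub,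
    ← smul_eq_mul, smul_neg_iff_of_pos_left (Real.exp_pos _)]

theorem norm_one_sub_exp_le_iff {w : ℂ} {r : ℝ} (hr : 0 ≤ r) :
    ‖1 - exp w‖ ≤ r ↔
      Real.exp w.re + (1 - r ^ 2) * Real.exp (-w.re) - 2 * Real.cos w.im ≤ 0 := by
  rw [← sq_le_sq₀ (norm_nonneg _) hr, ← sub_nonpos, ← exp_mul_eq_normSq_one_sub_exp_sub,
    ← smul_eq_mul, smul_nonpos_iff_nonpos_of_pos_left (Real.exp_pos _)]

/-- The logarithm of a disk about `1` of radius at most `1` is strictly convex. -/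
theorem norm_one_sub_exp_convexComb_lt {a b : ℂ} {r t : ℝ} (hr : 0 ≤ r) (hr1 : r ≤ 1)
    (ht : 0 < t) (ht1 : t < 1) (ha : |a.im| < Real.pi / 2) (hb : |b.im| < Real.pi / 2)
    (har : ‖1 - exp a‖ < r) (hbr : ‖1 - exp b‖ ≤ r) :
    ‖1 - exp (t * a + (1 - t) * b)‖ < r := by
  rw [norm_one_sub_exp_lt_iff hr] at har ⊢
  rw [norm_one_sub_exp_le_iff hr] at hbr
  have hre : (t * a + (1 - t) * b).re = t * a.re + (1 - t) * b.re := by simp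
  have him : (t * a + (1 - t) * b).im = t * a.im + (1 - t) * b.im := by simp
  rw [hre, him]
  have h1 := convexOn_exp.2 (mem_univ a.re) (mem_univ b.re) ht.le (sub_pos.2 ht1).le (by ring)
  have h2 := convexOn_exp.2 (mem_univ (-a.re)) (mem_univ (-b.re)) ht.le (sub_pos.2 ht1).le (by ring)
  have h3 := strictConcaveOn_cos_Icc.concaveOn.2 (x := a.im) (y := b.im)
    ⟨(abs_lt.1 ha).1.le, (abs_lt.1 ha).2.le⟩ ⟨(abs_lt.1 hb).1.le, (abs_lt.1 hb).2.le⟩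
    ht.le (sub_pos.2 ht1).le (by ring)
  simp only [smul_eq_mul] at h1 h2 h3
  have h4 : t * -a.re + (1 - t) * -b.re = -(t * a.re + (1 - t) * b.re) := by ring
  rw [h4] at h2
  have hc : 0 ≤ 1 - r ^ 2 := by nlinarith
  have h5 := mul_le_mul_of_nonneg_left h2 hc
  have h6 := mul_neg_of_pos_of_neg ht har
  have h7 := mul_nonpos_of_nonneg_of_nonpos (sub_pos.2 ht1).le hbr
  linarith

/-! ### The Marx–Strohhäcker estimate -/

/-- The Marx–Strohhäcker estimate: if `k` is starlike of order `1/2` and `k z = z * exp (M z)`, then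
`z / k z = 1 - ω z` for a Schwarz function `ω`. -/
theorem norm_one_sub_exp_neg_lt_one {M : ℂ → ℂ} (hM : DifferentiableOn ℂ M (ball 0 1))
    (hM0 : M 0 = 0) (hre : ∀ z ∈ ball (0 : ℂ) 1, z ≠ 0 → -(1 / 2) < (z * deriv M z).re)
    {z : ℂ} (hz : z ∈ ball (0 : ℂ) 1) : ‖1 - exp (-M z)‖ < 1 := by
  by_contra! hcon
  set ω : ℂ → ℂ := fun z => 1 - exp (-M z) with hω
  have hωd : DifferentiableOn ℂ ω (ball 0 1) := by fun_prop
  have hz1 : ‖z‖ < 1 := by simpa using hz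
  have hsub : closedBall (0 : ℂ) ‖z‖ ⊆ ball 0 1 := closedBall_subset_ball hz1
  have hcomp : IsCompact (closedBall (0 : ℂ) ‖z‖ ∩ (fun x => ‖ω x‖) ⁻¹' Ici 1) := by
    refine (isCompact_closedBall _ _).of_isClosed_subset ?_ inter_subset_left
    exact (hωd.continuousOn.mono hsub).norm.preimage_isClosed_of_isClosed isClosed_closedBall
      isClosed_Ici
  -- As in Jack's lemma, take a point of least modulus with `|ω| ≥ 1`; there `|ω| = 1`, and
  -- Schwarz's lemma applies on the disk of radius `|z₀|`.
  obtain ⟨z₀, ⟨hz₀, hωz₀⟩, hmin⟩ := hcomp.exists_isMinOn ⟨z, by simp, hcon⟩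
    (continuous_norm.continuousOn)
  have hz₀b := hsub hz₀
  simp only [mem_preimage, mem_Ici] at hωz₀
  have hω0 : ω 0 = 0 := by simp [hω, hM0]
  have hz₀ne : z₀ ≠ 0 := by
    rintro rfl
    norm_num [hω0] at hωz₀
  have hR : 0 < ‖z₀‖ := norm_pos_iff.2 hz₀ne
  have hR1 : ‖z₀‖ < 1 := by simpa using hz₀b
  have hlt : ∀ x, ‖x‖ < ‖z₀‖ → ‖ω x‖ < 1 := by
    intro x hx
    by_contra! h
    have hx' : x ∈ closedBall (0 : ℂ) ‖z‖ := by
      have : ‖z₀‖ ≤ ‖z‖ := by simpa using hz₀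
      simpa using hx.le.trans this
    exact absurd (hmin ⟨hx', h⟩) (by simpa using hx)
  have hsch : ∀ x, ‖x‖ < ‖z₀‖ → ‖ω x‖ ≤ 1 / ‖z₀‖ * ‖x‖ := by
    intro x hx
    have := dist_le_div_mul_dist_of_mapsTo_ball (f := ω) (c := 0) (R₁ := ‖z₀‖) (R₂ := 1)
      (hωd.mono (ball_subset_ball hR1.le))
      (fun y hy => by
        rw [hω0]
        simpa using (hlt y (by simpa using hy)).le) (z := x) (by simpa using hx)
    simpa [hω0] using this
  have hone : ‖ω z₀‖ = 1 := by
    refine le_antisymm ?_ hωz₀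
    have hcl : z₀ ∈ closure (ball (0 : ℂ) ‖z₀‖) := by
      rw [closure_ball _ hR.ne']; simp
    have hcw : ContinuousWithinAt ω (ball 0 ‖z₀‖) z₀ :=
      (hωd.continuousOn z₀ hz₀b).mono (ball_subset_ball hR1.le)
    have := hcw.mem_closure hcl (t := closedBall 0 1) (fun y hy => by
      simpa using (hlt y (by simpa using hy)).le)
    simpa [isClosed_closedBall.closure_eq] using this
  have hMd : HasDerivAt M (deriv M z₀) z₀ :=
    (hM.differentiableAt (isOpen_ball.mem_nhds hz₀b)).hasDerivAt
  have hωder : HasDerivAt ω (deriv M z₀ * (1 - ω z₀)) z₀ := by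
    refine (hMd.neg.cexp.const_sub 1).congr_deriv ?_
    simp only [hω, Pi.neg_apply]
    ring
  set v := ω z₀ with hv
  have hvne : v ≠ 1 := by
    intro h
    have : exp (-M z₀) = 0 := by
      have : 1 - exp (-M z₀) = 1 := h
      linear_combination -this
    exact exp_ne_zero _ this
  have hvsq : v.re ^ 2 + v.im ^ 2 = 1 := by
    have := Complex.sq_norm v
    rw [hone, Complex.normSq_apply] at this
    linarith
  have hcne : starRingEnd ℂ v - 1 ≠ 0 := by
    intro h
    apply hvne
    have : starRingEnd ℂ v = 1 := by linear_combination h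
    simpa using congrArg (starRingEnd ℂ) this
  -- As `|v| = 1`, `conj v * (1 - v) = conj v - 1`; this `ζ` cancels that factor in the derivative
  -- of `|ω|²`, leaving `2 Re (z₀ M')`. Also `Re ζ = -1/2`, so the ray enters the disk.
  set ζ := (starRingEnd ℂ v - 1)⁻¹ with hζ
  have hζre : ζ.re = -(1 / 2) := by
    have h2 : Complex.normSq (starRingEnd ℂ v - 1) = 2 - 2 * v.re := by
      rw [Complex.normSq_apply]
      simp
      linarith
    have h3 : Complex.normSq (starRingEnd ℂ v - 1) ≠ 0 := by simpa using hcne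
    rw [hζ, Complex.inv_re, h2]
    rw [h2] at h3
    have h4 : 1 - v.re ≠ 0 := fun h => h3 (by linarith)
    simp only [sub_re, conj_re, one_re]
    field_simp
    ring
  -- Compare along the ray `z₀ * (1 + t ζ)`
  have hline : HasDerivAt (fun t : ℝ => z₀ * (1 + t * ζ)) (z₀ * ζ) 0 := by
    have h := ((hasDerivAt_id (0 : ℝ)).ofReal_comp.mul_const ζ).const_add 1 |>.const_mul z₀
    simpa using h
  have hωline : HasDerivAt (fun t : ℝ => ω (z₀ * (1 + t * ζ)))
      (deriv M z₀ * (1 - v) * (z₀ * ζ)) 0 := by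
    refine HasDerivAt.comp (0 : ℝ) (h₂ := ω) ?_ hline
    simpa using hωder
  have hN : HasDerivAt (fun t : ℝ => ‖1 + (t : ℂ) * ζ‖ ^ 2 - ‖ω (z₀ * (1 + t * ζ))‖ ^ 2)
      (-1 - 2 * (z₀ * deriv M z₀).re) 0 := by
    have h1 : HasDerivAt (fun t : ℝ => 1 + (t : ℂ) * ζ) ζ 0 := by
      simpa using ((hasDerivAt_id (0 : ℝ)).ofReal_comp.mul_const ζ).const_add 1
    refine (h1.norm_sq.sub hωline.norm_sq).congr_deriv ?_
    have hk : starRingEnd ℂ v * (deriv M z₀ * (1 - v) * (z₀ * ζ)) = z₀ * deriv M z₀ := by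
      have h4 : starRingEnd ℂ v * v = 1 := by
        rw [← Complex.normSq_eq_conj_mul_self, Complex.normSq_eq_norm_sq, hone]; simp
      have h5 : (starRingEnd ℂ v - 1) * ζ = 1 := mul_inv_cancel₀ hcne
      linear_combination (z₀ * deriv M z₀) * h5 - (z₀ * deriv M z₀ * ζ) * h4
    have hk' := congrArg Complex.re hk
    simp only [Complex.inner, ofReal_zero, zero_mul, add_zero, mul_one, map_one]
    rw [← hv, hζre]
    rw [mul_comm] at hk'
    rw [hk']
    ring
  have hpos : ∀ᶠ t : ℝ in 𝓝[>] 0,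
      0 ≤ ‖1 + (t : ℂ) * ζ‖ ^ 2 - ‖ω (z₀ * (1 + t * ζ))‖ ^ 2 := by
    -- `|1 + tζ|² = 1 - t (1 - t |ζ|²)`.
    have hev : ∀ᶠ t : ℝ in 𝓝 0, t * Complex.normSq ζ < 1 := by
      have : ContinuousAt (fun t : ℝ => t * Complex.normSq ζ) 0 := by fun_prop
      exact this.eventually_lt continuousAt_const (by simp)
    filter_upwards [nhdsWithin_le_nhds hev, self_mem_nhdsWithin] with t ht (ht0 : 0 < t)
    have hsq : ‖1 + (t : ℂ) * ζ‖ ^ 2 < 1 := by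
      rw [Complex.sq_norm, Complex.normSq_apply]
      rw [Complex.normSq_apply] at ht
      simp only [add_re, one_re, re_ofReal_mul, add_im, one_im, im_ofReal_mul, hζre] at ht ⊢
      nlinarith
    have hlt1 : ‖1 + (t : ℂ) * ζ‖ < 1 := by
      by_contra! h
      nlinarith
    have := hsch (z₀ * (1 + t * ζ)) (by
      rw [norm_mul]; exact mul_lt_of_lt_one_right hR hlt1)
    rw [norm_mul, ← mul_assoc, one_div, inv_mul_cancel₀ hR.ne', one_mul] at this
    exact sub_nonneg.2 (pow_le_pow_left₀ (norm_nonneg _) this 2)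
  have hslope := (hasDerivWithinAt_iff_tendsto_slope' (s := Ioi (0 : ℝ)) (by simp)).1
    hN.hasDerivWithinAt
  have hge := ge_of_tendsto hslope (b := 0) (by
    filter_upwards [hpos, self_mem_nhdsWithin] with t ht (ht0 : 0 < t)
    rw [slope_def_field]
    refine div_nonneg ?_ (by linarith)
    simpa [← hv, hone] using ht)
  have := hre z₀ hz₀b hz₀ne
  linarith

/-- Schwarz's lemma sharpens the bound to the radius of the circle about `1` on which `1 - z` lies.
-/
theorem norm_one_sub_exp_neg_le {M : ℂ → ℂ} (hM : DifferentiableOn ℂ M (ball 0 1))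
    (hM0 : M 0 = 0) (hre : ∀ z ∈ ball (0 : ℂ) 1, z ≠ 0 → -(1 / 2) < (z * deriv M z).re)
    {z : ℂ} (hz : z ∈ ball (0 : ℂ) 1) : ‖1 - exp (-M z)‖ ≤ ‖z‖ := by
  have hd : DifferentiableOn ℂ (fun z => 1 - exp (-M z)) (ball 0 1) := by fun_prop
  exact norm_le_norm_of_mapsTo_ball hd
    (fun x hx => by simpa using (norm_one_sub_exp_neg_lt_one hM hM0 hre hx).le)
    (by simp [hM0]) (by simpa using hz)

/-- The bound forces `cos (Im M) > 0`, so by connectedness `Im M` never leaves the component of `0`.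
-/
theorem abs_im_lt_pi_div_two_of_norm_one_sub_exp_neg_lt {M : ℂ → ℂ}
    (hM : ContinuousOn M (ball 0 1)) (hM0 : M 0 = 0)
    (hlt : ∀ z ∈ ball (0 : ℂ) 1, ‖1 - exp (-M z)‖ < 1) {z : ℂ} (hz : z ∈ ball (0 : ℂ) 1) :
    |(M z).im| < Real.pi / 2 := by
  have hcos : ∀ x ∈ ball (0 : ℂ) 1, 0 < Real.cos (M x).im := by
    intro x hx
    have h := (norm_one_sub_exp_lt_iff zero_le_one).1 (hlt x hx)
    rw [neg_im, Real.cos_neg] at h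
    nlinarith [Real.exp_pos (-M x).re]
  have hpre : IsPreconnected ((fun x => |(M x).im|) '' ball (0 : ℂ) 1) :=
    (convex_ball (0 : ℂ) 1).isPreconnected.image _ (continuous_im.comp_continuousOn hM).abs
  by_contra! h
  obtain ⟨x, hx, hxe⟩ := hpre.ordConnected.out (x := 0) (y := |(M z).im|) ⟨0, by simp, by simp [hM0]⟩
    ⟨z, hz, rfl⟩ ⟨by positivity, h⟩
  have := hcos x hx
  rw [← Real.cos_abs] at this
  simp only at hxe
  simp [hxe] at this

/-! ### Covering the logarithm of the unit disk about 1 -/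

theorem isPreconnected_log_ball :
    IsPreconnected {w : ℂ | |w.im| < Real.pi / 2 ∧ ‖1 - exp w‖ < 1} := by
  refine Convex.isPreconnected fun a ha b hb x y hx hy hxy => ?_
  rcases hx.eq_or_lt with rfl | hx
  · obtain rfl : y = 1 := by linarith
    simpa using hb
  rcases hy.eq_or_lt with rfl | hy
  · obtain rfl : x = 1 := by linarith
    simpa using ha
  obtain rfl : y = 1 - x := by linarith
  constructor
  · obtain ⟨ha1, ha2⟩ := abs_lt.1 ha.1
    obtain ⟨hb1, hb2⟩ := abs_lt.1 hb.1
    simp only [add_im, real_smul, im_ofReal_mul]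
    rw [abs_lt]
    constructor <;> nlinarith
  · simpa using norm_one_sub_exp_convexComb_lt zero_le_one le_rfl hx (by linarith) ha.1 hb.1
      ha.2 hb.2.le

theorem log_ball_subset_image {M : ℂ → ℂ} {β : ℝ} (hβ0 : 0 < β) (hβ1 : β < 1)
    (hM : DifferentiableOn ℂ M (ball 0 1)) (hM0 : M 0 = 0)
    (hre : ∀ z ∈ ball (0 : ℂ) 1, z ≠ 0 → -(1 / 2) < (z * deriv M z).re) :
    {w : ℂ | |w.im| < Real.pi / 2 ∧ ‖1 - exp w‖ < 1} ⊆
      (fun z => (log (1 - z) + (1 - β) * M z) / β) '' ball 0 1 := by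
  set W : ℂ → ℂ := fun z => (log (1 - z) + (1 - β) * M z) / β with hW
  have hβc : (β : ℂ) ≠ 0 := by exact_mod_cast hβ0.ne'
  have hslit : ∀ z ∈ ball (0 : ℂ) 1, 0 < (1 - z).re := by
    intro z hz
    have h1 : ‖z‖ < 1 := by simpa using hz
    have := (re_le_norm z).trans_lt h1
    simpa using this
  have hWd : DifferentiableOn ℂ W (ball 0 1) := by
    have hlog : DifferentiableOn ℂ (fun z : ℂ => log (1 - z)) (ball 0 1) :=
      DifferentiableOn.clog (by fun_prop) fun z hz => Or.inl (hslit z hz)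
    exact (hlog.add (hM.const_mul _)).div_const _
  have hW0 : W 0 = 0 := by simp [hW, hM0]
  have key : ∀ z ∈ ball (0 : ℂ) 1, |(W z).im| < Real.pi / 2 → ‖z‖ ≤ ‖1 - exp (W z)‖ := by
    intro z hz him
    by_contra! h
    have h1 : ‖z‖ < 1 := by simpa using hz
    have hMim : |(-M z).im| < Real.pi / 2 := by
      rw [neg_im, abs_neg]
      exact abs_im_lt_pi_div_two_of_norm_one_sub_exp_neg_lt hM.continuousOn hM0
        (fun x hx => norm_one_sub_exp_neg_lt_one hM hM0 hre hx) hz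
    have hlt := norm_one_sub_exp_convexComb_lt (norm_nonneg z) h1.le hβ0 hβ1 him hMim h
      (norm_one_sub_exp_neg_le hM hM0 hre hz)
    have heq : (β : ℂ) * W z + (1 - β) * -M z = log (1 - z) := by
      simp only [hW]; field_simp; ring
    have hne : (1 : ℂ) - z ≠ 0 := fun h0 => by simpa [h0] using hslit z hz
    rw [heq, exp_log hne, sub_sub_cancel] at hlt
    exact lt_irrefl _ hlt
  have hopen : IsOpen (W '' ball 0 1) := by
    rcases (hWd.analyticOnNhd isOpen_ball).is_constant_or_isOpen
      (convex_ball (0 : ℂ) 1).isPreconnected with ⟨w, hw⟩ | h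
    · exfalso
      have h0 : w = 0 := by rw [← hw 0 (by simp), hW0]
      have hmem : (1 / 2 : ℂ) ∈ ball (0 : ℂ) 1 := by norm_num
      have := key (1 / 2) hmem (by rw [hw _ hmem, h0]; simpa using Real.pi_pos)
      rw [hw _ hmem, h0] at this
      norm_num at this
    · exact h _ subset_rfl isOpen_ball
  refine isPreconnected_log_ball.subset_of_closure_inter_subset hopen
    ⟨0, by simpa using Real.pi_pos, 0, by simp, hW0⟩ ?_
  rintro w ⟨hwc, hwim, hwn⟩
  -- Near `w`, values of `W` in the strip have `|1 - exp W| < r`, so by `key` they come from the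
  -- compact disk of radius `r`, whose image is closed.
  obtain ⟨r, hwr, hr⟩ := exists_between hwn
  set T : Set ℂ := {w | |w.im| < Real.pi / 2 ∧ ‖1 - exp w‖ < r} with hT
  have hTo : IsOpen T := by
    rw [hT, ofPred_and]
    exact (isOpen_lt continuous_im.abs continuous_const).inter
      (isOpen_lt (continuous_const.sub continuous_exp).norm continuous_const)
  have hsub : closedBall (0 : ℂ) r ⊆ ball 0 1 := closedBall_subset_ball hr
  have hcl : IsClosed (W '' closedBall 0 r) :=
    ((isCompact_closedBall _ _).image_of_continuousOn (hWd.continuousOn.mono hsub)).isClosed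
  have hmem : w ∈ closure (T ∩ W '' ball 0 1) := hTo.inter_closure ⟨⟨hwim, hwr⟩, hwc⟩
  have hle : T ∩ W '' ball 0 1 ⊆ W '' closedBall 0 r := by
    rintro _ ⟨⟨h1, h2⟩, z, hz, rfl⟩
    exact ⟨z, by simpa using (key z hz h1).trans h2.le, rfl⟩
  exact image_mono hsub (closure_minimal hle hcl hmem)

/-! ### The holomorphic logarithm of s(z)/z -/

theorem exists_log_of_differentiableOn_ball {g : ℂ → ℂ} (hg : DifferentiableOn ℂ g (ball 0 1))
    (hg0 : g 0 = 1) (hne : ∀ z ∈ ball (0 : ℂ) 1, g z ≠ 0) :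
    ∃ L : ℂ → ℂ, DifferentiableOn ℂ L (ball 0 1) ∧ L 0 = 0 ∧
      ∀ z ∈ ball (0 : ℂ) 1, exp (L z) = g z := by
  have hd : DifferentiableOn ℂ (fun z => deriv g z / g z) (ball 0 1) :=
    (hg.deriv isOpen_ball).div hg hne
  obtain ⟨L₁, hL₁⟩ := hd.isExactOn_ball
  set L : ℂ → ℂ := fun z => L₁ z - L₁ 0 with hLdef
  have hL : ∀ z ∈ ball (0 : ℂ) 1, HasDerivAt L (deriv g z / g z) z :=
    fun z hz => (hL₁ z hz).sub_const _
  have hL0 : L 0 = 0 := by simp [hLdef]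
  refine ⟨L, fun z hz => (hL z hz).differentiableAt.differentiableWithinAt, hL0, fun z hz => ?_⟩
  have hder : ∀ x ∈ ball (0 : ℂ) 1, HasDerivAt (fun x => g x * exp (-L x)) 0 x := by
    intro x hx
    refine ((hg.differentiableAt (isOpen_ball.mem_nhds hx)).hasDerivAt.mul
      (hL x hx).fun_neg.cexp).congr_deriv ?_
    field_simp [hne x hx]
    ring
  have hconst := isOpen_ball.is_const_of_deriv_eq_zero (convex_ball (0 : ℂ) 1).isPreconnected
    (fun x hx => (hder x hx).differentiableAt.differentiableWithinAt)
    (fun x hx => (hder x hx).deriv) hz (mem_ball_self one_pos)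
  simp only [hg0, hL0, neg_zero, exp_zero, mul_one, exp_neg] at hconst
  exact (eq_of_mul_inv_eq_one hconst).symm

theorem exists_isQuotientPowerBranch {s : ℂ → ℂ} (hs : DifferentiableOn ℂ s (ball 0 1))
    (hinj : InjOn s (ball 0 1)) (hs0 : s 0 = 0) (hs1 : deriv s 0 = 1) (c : ℂ) :
    ∃ p : ℂ → ℂ, IsQuotientPowerBranch s c p := by
  have h0 : (0 : ℂ) ∈ ball (0 : ℂ) 1 := mem_ball_self one_pos
  have hval : ∀ z, z ≠ 0 → dslope s 0 z = s z / z := by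
    intro z hz
    rw [dslope_of_ne _ hz, slope_def_field, hs0, sub_zero, sub_zero]
  -- `dslope s 0` is `s z / z` with the singularity removed; injectivity of `s` excludes zeros.
  obtain ⟨L, hL, hL0, hexp⟩ := exists_log_of_differentiableOn_ball (g := dslope s 0)
    ((differentiableOn_dslope (isOpen_ball.mem_nhds h0)).2 hs) (by rw [dslope_same, hs1])
    (fun z hz => by
      rcases eq_or_ne z 0 with rfl | hz0
      · rw [dslope_same, hs1]; exact one_ne_zero
      · rw [hval z hz0]
        exact div_ne_zero (fun h => hz0 (hinj hz h0 (h.trans hs0.symm))) hz0)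
  exact ⟨_, L, hL, hL0, fun z hz hz0 => (hexp z hz).trans (hval z hz0), fun _ _ => rfl⟩

theorem mul_deriv_log_div_self {s L : ℂ → ℂ} (hs : DifferentiableOn ℂ s (ball 0 1))
    (hL : DifferentiableOn ℂ L (ball 0 1))
    (hexp : ∀ z ∈ ball (0 : ℂ) 1, z ≠ 0 → exp (L z) = s z / z)
    {z : ℂ} (hz : z ∈ ball (0 : ℂ) 1) (hz0 : z ≠ 0) :
    z * deriv L z = z * deriv s z / s z - 1 := by
  have hnhds := isOpen_ball.mem_nhds hz
  have h1 := (hL.differentiableAt hnhds).hasDerivAt.cexp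
  have h2 := (hs.differentiableAt hnhds).hasDerivAt.div (hasDerivAt_id z) hz0
  have heq : (fun x => exp (L x)) =ᶠ[𝓝 z] s / id := by
    filter_upwards [hnhds, isOpen_ne.mem_nhds hz0] with x hx hx0 using hexp x hx hx0
  have h3 := h1.unique (h2.congr_of_eventuallyEq heq)
  have hsz : s z ≠ 0 := by
    intro h
    have := hexp z hz hz0
    rw [h, zero_div] at this
    exact exp_ne_zero _ this
  rw [hexp z hz hz0] at h3
  simp only [id] at h3
  field_simp at h3 ⊢
  linear_combination h3

/-! ### The covering theorems for Q -/

theorem ball_subset_image_one_sub_quotientPowerBranch {φ α β : ℝ} {μ : ℂ} {s p : ℂ → ℂ}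
    (hα : α < Real.cos φ) (hβ0 : 0 < β) (hβ1 : β < 1)
    (hμ : μ = exp (φ * I) * ((2 * (Real.cos φ - α) / (1 - β) : ℝ) : ℂ))
    (hs : DifferentiableOn ℂ s (ball 0 1))
    (hspiral : ∀ z ∈ ball (0 : ℂ) 1, z ≠ 0 →
      α < (exp (-(φ * I)) * (z * deriv s z / s z)).re)
    (hp : IsQuotientPowerBranch s (1 / (μ * β)) p) :
    ball (0 : ℂ) 1 ⊆ (fun z : ℂ => 1 - (1 - z) ^ (1 / (β : ℂ)) * p z) '' ball (0 : ℂ) 1 := by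
  obtain ⟨L, hL, hL0, hexp, hpL⟩ := hp
  set d : ℝ := 2 * (Real.cos φ - α) with hd
  have hd0 : 0 < d := by rw [hd]; linarith
  set M : ℂ → ℂ := fun z => (exp (-(φ * I)) / d) * L z with hM
  have hre : ∀ z ∈ ball (0 : ℂ) 1, z ≠ 0 → -(1 / 2) < (z * deriv M z).re := by
    intro z hz hz0
    have hder : deriv M z = (exp (-(φ * I)) / d) * deriv L z :=
      deriv_const_mul _ (hL.differentiableAt (isOpen_ball.mem_nhds hz))
    have hrw : z * deriv M z =
        (exp (-(φ * I)) * (z * deriv s z / s z) - exp (-(φ * I))) / d := by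
      rw [hder]
      linear_combination (exp (-(φ * I)) / d) * mul_deriv_log_div_self hs hL hexp hz hz0
    have hcos : (exp (-(φ * I))).re = Real.cos φ := by
      rw [exp_re]; simp
    rw [hrw, div_ofReal_re, sub_re, hcos, lt_div_iff₀ hd0]
    have := hspiral z hz hz0
    linarith
  have hsub := log_ball_subset_image hβ0 hβ1 (M := M) (hL.const_mul _) (by simp [hM, hL0]) hre
  intro w hw
  have hw1 : ‖w‖ < 1 := by simpa using hw
  have hwre : 0 < (1 - w).re := by simpa using (re_le_norm w).trans_lt hw1
  have hne : (1 : ℂ) - w ≠ 0 := fun h => by simp [h] at hwre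
  obtain ⟨z, hz, hzw⟩ := hsub (show log (1 - w) ∈ _ from
    ⟨by rw [log_im]; exact abs_arg_lt_pi_div_two_iff.2 (Or.inl hwre), by
      rwa [exp_log hne, sub_sub_cancel]⟩)
  refine ⟨z, hz, ?_⟩
  have hz1 : ‖z‖ < 1 := by simpa using hz
  have hzre : 0 < (1 - z).re := by simpa using (re_le_norm z).trans_lt hz1
  have hzne : (1 : ℂ) - z ≠ 0 := fun h => by simp [h] at hzre
  have hβc : (β : ℂ) ≠ 0 := by exact_mod_cast hβ0.ne'
  have hβc1 : (1 : ℂ) - β ≠ 0 := by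
    have : (1 : ℝ) - β ≠ 0 := by linarith
    exact_mod_cast this
  have hdc : (d : ℂ) ≠ 0 := by exact_mod_cast hd0.ne'
  have hQ : (1 - z) ^ (1 / (β : ℂ)) * p z = 1 - w := by
    rw [hpL z hz, cpow_def_of_ne_zero hzne, ← exp_add, ← exp_log hne, ← hzw]
    congr 1
    simp only [hM, hμ, exp_neg]
    push_cast
    have := exp_ne_zero (φ * I)
    field_simp
  simp only [hQ, sub_sub_cancel]

end

theorem corollary3p3 (φ α β : ℝ) (μ : ℂ) (s : ℂ → ℂ)
    (hφ : φ ∈ Set.Ioo (-(Real.pi / 2)) (Real.pi / 2))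
    (hα : α < Real.cos φ)
    (hβ : β ∈ Set.Ioc 0 (α / Real.cos φ))
    (hμ : μ = Complex.exp (φ * Complex.I) * ((2 * (Real.cos φ - α) / (1 - β) : ℝ) : ℂ))
    (hs : DifferentiableOn ℂ s (Metric.ball 0 1))
    (hinj : Set.InjOn s (Metric.ball 0 1))
    (hs0 : s 0 = 0) (hs1 : deriv s 0 = 1)
    (hspiral : ∀ z ∈ Metric.ball (0 : ℂ) 1, z ≠ 0 →
      α < (Complex.exp (-(φ * Complex.I)) * (z * deriv s z / s z)).re) :
    (∃ p : ℂ → ℂ, IsQuotientPowerBranch s (1 / (μ * β)) p) ∧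
    ∀ p : ℂ → ℂ, IsQuotientPowerBranch s (1 / (μ * β)) p →
      Metric.ball (0 : ℂ) 1 ⊆
          (fun z : ℂ => 1 - (1 - z) ^ (1 / (β : ℂ)) * p z) '' Metric.ball (0 : ℂ) 1 ∧
        {w : ℂ | 0 < w.re} ⊆
          (fun z : ℂ => (1 - z) ^ (1 / (β : ℂ)) * p z / (2 - (1 - z) ^ (1 / (β : ℂ)) * p z)) ''
            {z ∈ Metric.ball (0 : ℂ) 1 | 2 - (1 - z) ^ (1 / (β : ℂ)) * p z ≠ 0} := by
  have hcos : 0 < Real.cos φ := Real.cos_pos_of_mem_Ioo hφ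
  have hβ1 : β < 1 := hβ.2.trans_lt ((div_lt_one hcos).2 hα)
  refine ⟨exists_isQuotientPowerBranch hs hinj hs0 hs1 _, fun p hp => ?_⟩
  have hball := ball_subset_image_one_sub_quotientPowerBranch hα hβ.1 hβ1 hμ hs hspiral hp
  refine ⟨hball, fun w (hw : 0 < w.re) => ?_⟩
  have hw1 : w + 1 ≠ 0 := by
    intro h
    have := congrArg Complex.re h
    simp at this
    linarith
  -- Solving `Q / (2 - Q) = w` gives `1 - Q = (1 - w) / (w + 1)`, the Cayley transform of the
  -- half-plane onto the disk.
  have hmem : (1 - w) / (w + 1) ∈ Metric.ball (0 : ℂ) 1 := by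
    rw [mem_ball_zero_iff, norm_div, div_lt_one (norm_pos_iff.2 hw1),
      ← sq_lt_sq₀ (norm_nonneg _) (norm_nonneg _), Complex.sq_norm, Complex.sq_norm,
      Complex.normSq_apply, Complex.normSq_apply]
    simp
    nlinarith
  obtain ⟨z, hz, hzw⟩ := hball hmem
  have hQ : (1 - z) ^ (1 / (β : ℂ)) * p z = 2 * w / (w + 1) := by
    simp only at hzw
    have : (1 - z) ^ (1 / (β : ℂ)) * p z = 1 - (1 - w) / (w + 1) := by rw [← hzw]; ring
    rw [this]
    field_simp
    ring
  have h2 : 2 - 2 * w / (w + 1) = 2 / (w + 1) := by field_simp; ring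
  refine ⟨z, ⟨hz, ?_⟩, ?_⟩
  · rw [hQ, h2]
    exact div_ne_zero two_ne_zero hw1
  · simp only [hQ, h2]
    field_simp
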